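/- Let $C\subset\mathbb{R}^n$ be a closed convex set with nonempty interior, let $F_\theta\colon\mathbb{R}^n\to\mathbb{R}^n$ be continuous on $C$ and monotone on $C$, i.e. $\langle F_\theta(x)-F_\theta(z), x-z\rangle\ge 0$ for all $x,z\in C$. Let $y\in\mathbb{R}^n$, let $\varrho\in[0,+\infty[$, and let $r\colon\mathbb{R}^n\to\mathbb{R}$ be differentiable and convex. For $x\in C$, let $N_C(x)=\{u\in\mathbb{R}^n \mid \langle z-x,u\rangle\le 0 \text{ for all } z\in C\}$ be the normal cone to $C$ at $x$, and let $N_C(x)=\varnothing$ for $x\notin C$. Assume that one of the following holds: (i) $\varrho>0$ and $r$ is strongly convex (that is, $\beta$-strongly convex on $\mathbb{R}^n$ for some $\beta>0$); (ii) $C$ is bounded. Then there exists $\widehat{x}\in\mathbb{R}^n$ such that $$0\in F_\theta(\widehat{x})-y+\varrho\nabla r(\widehat{x})+N_C(\widehat{x}).$$ -/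

import Mathlib

open scoped Pointwise

/-- The normal cone `N_C(x)` to a set `C ⊆ ℝⁿ`: if `x ∈ C` it is the set of all `u` with
`⟪z - x, u⟫ ≤ 0` for every `z ∈ C`, and it is empty if `x ∉ C`. -/
def normalCone {n : ℕ} (C : Set (EuclideanSpace ℝ (Fin n))) (x : EuclideanSpace ℝ (Fin n)) :
    Set (EuclideanSpace ℝ (Fin n)) :=
  {u | x ∈ C ∧ ∀ z ∈ C, inner ℝ (z - x) u ≤ 0}

/-- The single-valued operator `T` is monotone on `C`. -/
def IsMonotoneOperatorOn {n : ℕ} (T : EuclideanSpace ℝ (Fin n) → EuclideanSpace ℝ (Fin n))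
    (C : Set (EuclideanSpace ℝ (Fin n))) : Prop :=
  ∀ x ∈ C, ∀ z ∈ C, 0 ≤ inner ℝ (T x - T z) (x - z)

/-- `f : ℝⁿ → ℝ` is strongly convex: it is `β`-strongly convex for some `β > 0`. -/
def IsStronglyConvex {n : ℕ} (f : EuclideanSpace ℝ (Fin n) → ℝ) : Prop :=
  ∃ β : ℝ, 0 < β ∧ StrongConvexOn Set.univ β f

/-- `x` solves the inclusion `0 ∈ F(x) - y + ϱ ∇r(x) + N_C(x)`; the sum is the Minkowski sum of
the single-valued part and the normal cone. -/
def SolvesRegularizedInclusion {n : ℕ} (C : Set (EuclideanSpace ℝ (Fin n)))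
    (F : EuclideanSpace ℝ (Fin n) → EuclideanSpace ℝ (Fin n)) (y : EuclideanSpace ℝ (Fin n))
    (ϱ : ℝ) (r : EuclideanSpace ℝ (Fin n) → ℝ) (x : EuclideanSpace ℝ (Fin n)) : Prop :=
  (0 : EuclideanSpace ℝ (Fin n)) ∈
    ({F x - y + ϱ • gradient r x} : Set (EuclideanSpace ℝ (Fin n))) + normalCone C x

/-! The inclusion is a variational inequality, solved through its Minty form, where the operator is
evaluated at the test point `z`. That condition is closed in `x`, so on a compact set finitely many
test points suffice, and monotonicity reduces these to a matrix inequality on the simplex, proved by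
separation. Minty's lemma needs the condition only near `x`; hence for unbounded `C` it is enough to
solve on `C` cut by a ball so large that strong convexity keeps the solution off its boundary. -/

open Filter Topology in
/-- A convex function with modulus `m` lies above its tangent plane plus `m / 2 * ‖·‖ ^ 2`. -/
theorem StrongConvexOn.inner_gradient_add_le {E : Type*} [NormedAddCommGroup E]
    [InnerProductSpace ℝ E] [CompleteSpace E] {f : E → ℝ} {m : ℝ}
    (hf : StrongConvexOn Set.univ m f) {x : E} (hd : DifferentiableAt ℝ f x) (z : E) :
    inner ℝ (gradient f x) (z - x) + m / 2 * ‖x - z‖ ^ 2 ≤ f z - f x := by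
  have hline : HasDerivAt (fun t : ℝ => f (x + t • (z - x))) (inner ℝ (gradient f x) (z - x)) 0 := by
    have h := hd.hasGradientAt.hasFDerivAt.hasLineDerivAt (z - x)
    simpa [HasLineDerivAt] using h
  have hlim := hline.tendsto_slope_zero_right
  have hrem : Tendsto (fun t : ℝ => (1 - t) * (m / 2 * ‖x - z‖ ^ 2)) (𝓝[>] 0)
      (𝓝 (m / 2 * ‖x - z‖ ^ 2)) := by
    have : Continuous fun t : ℝ => (1 - t) * (m / 2 * ‖x - z‖ ^ 2) := by fun_prop
    simpa using (this.tendsto 0).mono_left nhdsWithin_le_nhds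
  -- Strong convexity at `x + t • (z - x)`, divided by `t`, is the claim up to terms converging as
  -- `t → 0⁺`.
  refine le_of_tendsto (hlim.add hrem) ?_
  filter_upwards [Ioo_mem_nhdsGT (zero_lt_one (α := ℝ))] with t ht
  have h := hf.2 (Set.mem_univ x) (Set.mem_univ z) (sub_nonneg.2 ht.2.le) ht.1.le (by ring)
  have hp : (1 - t) • x + t • z = x + t • (z - x) := by module
  rw [hp] at h
  simp only [smul_eq_mul, zero_add, zero_smul, add_zero] at h ⊢
  have h' : t⁻¹ * (f (x + t • (z - x)) - f x)
      ≤ t⁻¹ * (t * (f z - f x - (1 - t) * (m / 2 * ‖x - z‖ ^ 2))) :=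
    mul_le_mul_of_nonneg_left (by linarith) (inv_nonneg.2 ht.1.le)
  rw [inv_mul_cancel_left₀ ht.1.ne'] at h'
  linarith

/-- If `A + Aᵀ` has nonnegative entries, some `w` in the simplex satisfies `A w ≥ 0`. -/
theorem exists_mem_stdSimplex_forall_sum_nonneg {ι : Type*} [Fintype ι] [Nonempty ι]
    (A : ι → ι → ℝ) (hA : ∀ i j, 0 ≤ A i j + A j i) :
    ∃ w ∈ stdSimplex ℝ ι, ∀ i, 0 ≤ ∑ j, w j * A i j := by
  classical
  let L : (ι → ℝ) →ₗ[ℝ] (ι → ℝ) :=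
    { toFun := fun w i => ∑ j, w j * A i j
      map_add' := fun v w => by ext i; simp [add_mul, Finset.sum_add_distrib]
      map_smul' := fun c w => by ext i; simp [mul_assoc, Finset.mul_sum] }
  by_contra! hneg
  have hdisj : Disjoint (L '' stdSimplex ℝ ι) (Set.Ici (0 : ι → ℝ)) := by
    rw [Set.disjoint_left]
    rintro _ ⟨w, hw, rfl⟩ hnonneg
    obtain ⟨i, hi⟩ := hneg w hw
    exact hi.not_ge (hnonneg i)
  -- The separating functional has coefficients `c ≥ 0`, not all zero. Normalised, `c` is a point of
  -- the simplex, so `cᵀ A c < 0`, against the sign of `A + Aᵀ`.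
  obtain ⟨f, u, v, hfu, huv, hfv⟩ := geometric_hahn_banach_compact_closed
    ((convex_stdSimplex ℝ ι).linear_image L)
    ((isCompact_stdSimplex ℝ ι).image L.continuous_of_finiteDimensional)
    (convex_Ici (0 : ι → ℝ)) isClosed_Ici hdisj
  have hv : v < 0 := by simpa using hfv 0 (Set.mem_Ici.2 le_rfl)
  let c : ι → ℝ := fun i => f (Pi.single i 1)
  have hf (x : ι → ℝ) : f x = ∑ i, x i * c i := by
    conv_lhs => rw [pi_eq_sum_univ' x]
    simp [c]
  have hc (i : ι) : 0 ≤ c i := by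
    by_contra! hi
    -- The multiple is chosen so that `f` takes the value `v` exactly.
    have h := hfv ((v / c i) • Pi.single i 1)
      (Set.mem_Ici.2 <| smul_nonneg (div_nonneg_of_nonpos hv.le hi.le)
        (Pi.single_nonneg.2 zero_le_one))
    rw [map_smul, smul_eq_mul, div_mul_cancel₀ _ hi.ne] at h
    exact lt_irrefl _ h
  have hsum : 0 < ∑ i, c i := by
    refine (Finset.sum_nonneg fun i _ => hc i).lt_of_ne fun h0 => ?_
    have hc0 (i : ι) : c i = 0 :=
      (Finset.sum_eq_zero_iff_of_nonneg fun i _ => hc i).1 h0.symm i (Finset.mem_univ i)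
    have h := hfu _ ⟨_, single_mem_stdSimplex ℝ (Classical.arbitrary ι), rfl⟩
    rw [hf] at h
    simp only [hc0, mul_zero, Finset.sum_const_zero] at h
    linarith
  have hneg' : f (L c) < 0 := by
    have hw : (∑ i, c i)⁻¹ • c ∈ stdSimplex ℝ ι :=
      ⟨fun i => mul_nonneg (inv_nonneg.2 hsum.le) (hc i), by
        simp [← Finset.mul_sum, inv_mul_cancel₀ hsum.ne']⟩
    have h := hfu _ ⟨_, hw, rfl⟩
    rw [map_smul, map_smul, smul_eq_mul] at h
    have : (∑ i, c i)⁻¹ * f (L c) < 0 := by linarith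
    exact neg_of_mul_neg_right this (inv_nonneg.2 hsum.le)
  have hL : f (L c) = ∑ i, ∑ j, c i * c j * A i j := by
    rw [hf]
    refine Finset.sum_congr rfl fun i _ => ?_
    simp only [L, LinearMap.coe_mk, AddHom.coe_mk, Finset.sum_mul]
    exact Finset.sum_congr rfl fun j _ => by ring
  have hL' : f (L c) = ∑ i, ∑ j, c i * c j * A j i := by
    rw [hL, Finset.sum_comm]
    exact Finset.sum_congr rfl fun i _ => Finset.sum_congr rfl fun j _ => by ring
  have : 0 ≤ f (L c) + f (L c) := by
    nth_rw 1 [hL]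
    rw [hL', ← Finset.sum_add_distrib]
    refine Finset.sum_nonneg fun i _ => ?_
    rw [← Finset.sum_add_distrib]
    refine Finset.sum_nonneg fun j _ => ?_
    rw [← mul_add]
    exact mul_nonneg (mul_nonneg (hc i) (hc j)) (hA i j)
  linarith

/-- Existence for the Minty form of a monotone mixed variational inequality on a compact set. -/
theorem exists_minty_solution {E : Type*} [NormedAddCommGroup E] [InnerProductSpace ℝ E]
    {K : Set E} (hK : IsCompact K) (hconv : Convex ℝ K) (hne : K.Nonempty) {G : E → E}
    (hG : ∀ x ∈ K, ∀ z ∈ K, 0 ≤ inner ℝ (G x - G z) (x - z)) {φ : E → ℝ}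
    (hφ : ConvexOn ℝ K φ) (hφc : Continuous φ) :
    ∃ x ∈ K, ∀ z ∈ K, 0 ≤ inner ℝ (G z) (z - x) + (φ z - φ x) := by
  have key := hK.inter_iInter_nonempty
    (fun z : K => {x | 0 ≤ inner ℝ (G z) (z - x) + (φ z - φ x)})
    (fun z => isClosed_le continuous_const (by fun_prop)) ?_
  · obtain ⟨x, hxK, hx⟩ := key
    exact ⟨x, hxK, fun z hz => Set.mem_iInter.1 hx ⟨z, hz⟩⟩
  intro s
  rcases s.eq_empty_or_nonempty with rfl | hs
  · simpa using hne
  have : Nonempty s := hs.to_subtype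
  -- In `A i j + A j i` the `φ` terms cancel, leaving the monotonicity expression. The barycentre
  -- with weights `w` then works, by Jensen for `φ`.
  obtain ⟨w, ⟨hw0, hw1⟩, hw⟩ := exists_mem_stdSimplex_forall_sum_nonneg
    (fun i j : s => inner ℝ (G i) ((i : E) - j) + (φ i - φ j)) fun i j => by
      have h := hG i i.1.2 j j.1.2
      have hswap : inner ℝ (G j) ((j : E) - i) = -inner ℝ (G j) ((i : E) - j) := by
        rw [← inner_neg_right, neg_sub]
      rw [inner_sub_left] at h
      simp only [hswap]
      linarith
  refine ⟨∑ j, w j • (j : E), hconv.sum_mem (fun j _ => hw0 j) hw1 fun j _ => j.1.2, ?_⟩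
  simp only [Set.mem_iInter, Set.mem_ofPred_eq]
  intro z hz
  have hφle : φ (∑ j, w j • (j : E)) ≤ ∑ j, w j * φ j :=
    hφ.map_sum_le (fun j _ => hw0 j) hw1 fun j _ => j.1.2
  refine (hw ⟨z, hz⟩).trans ?_
  have hsplit : ∑ j : s, w j * (inner ℝ (G z) ((z : E) - j) + (φ z - φ j))
      = inner ℝ (G z) ((z : E) - ∑ j, w j • (j : E)) + (φ z - ∑ j, w j * φ j) := by
    simp only [mul_add, mul_sub, inner_sub_right, Finset.sum_add_distrib, Finset.sum_sub_distrib,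
      ← Finset.sum_mul, hw1, one_mul, inner_sum, inner_smul_right]
  simp only [hsplit]
  linarith

open Filter Topology in
/-- Minty's lemma: a solution of the Minty form near `x` solves the variational inequality. -/
theorem inner_add_gradient_nonneg_of_minty {E : Type*} [NormedAddCommGroup E]
    [InnerProductSpace ℝ E] [CompleteSpace E] {C : Set E} (hC : Convex ℝ C) {G : E → E} {x : E}
    (hx : x ∈ C) (hG : ContinuousWithinAt G C x) {f : E → ℝ} (hf : DifferentiableAt ℝ f x)
    {ϱ : ℝ} (hmin : ∀ᶠ z in 𝓝[C] x, 0 ≤ inner ℝ (G z) (z - x) + (ϱ * f z - ϱ * f x))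
    {z : E} (hz : z ∈ C) : 0 ≤ inner ℝ (G x + ϱ • gradient f x) (z - x) := by
  have hline : HasDerivAt (fun t : ℝ => f (x + t • (z - x))) (inner ℝ (gradient f x) (z - x)) 0 := by
    have h := hf.hasGradientAt.hasFDerivAt.hasLineDerivAt (z - x)
    simpa [HasLineDerivAt] using h
  have hseg : Tendsto (fun t : ℝ => x + t • (z - x)) (𝓝[>] 0) (𝓝[C] x) := by
    refine tendsto_nhdsWithin_iff.2 ⟨?_, ?_⟩
    · have : Continuous fun t : ℝ => x + t • (z - x) := by fun_prop
      simpa using (this.tendsto 0).mono_left nhdsWithin_le_nhds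
    · filter_upwards [Ioo_mem_nhdsGT (zero_lt_one (α := ℝ))] with t ht
      exact hC.add_smul_sub_mem hx hz ⟨ht.1.le, ht.2.le⟩
  have hlimG : Tendsto (fun t : ℝ => inner ℝ (G (x + t • (z - x))) (z - x)) (𝓝[>] 0)
      (𝓝 (inner ℝ (G x) (z - x))) := (hG.tendsto.comp hseg).inner tendsto_const_nhds
  rw [inner_add_left, real_inner_smul_left]
  -- Test with `x + t • (z - x)`, divide by `t`, let `t → 0⁺`.
  refine ge_of_tendsto (hlimG.add (hline.tendsto_slope_zero_right.const_mul ϱ)) ?_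
  filter_upwards [hseg.eventually hmin, self_mem_nhdsWithin] with t ht ht0
  have ht0 : 0 < t := ht0
  rw [add_sub_cancel_left, inner_smul_right] at ht
  have h := mul_nonneg (inv_nonneg.2 ht0.le) ht
  rw [mul_add, inv_mul_cancel_left₀ ht0.ne'] at h
  simp only [smul_eq_mul, zero_add, zero_smul, add_zero]
  linarith

theorem solvesRegularizedInclusion_of_forall_inner_nonneg {n : ℕ}
    {C : Set (EuclideanSpace ℝ (Fin n))} {F : EuclideanSpace ℝ (Fin n) → EuclideanSpace ℝ (Fin n)}
    {y : EuclideanSpace ℝ (Fin n)} {ϱ : ℝ} {r : EuclideanSpace ℝ (Fin n) → ℝ}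
    {x : EuclideanSpace ℝ (Fin n)} (hx : x ∈ C)
    (h : ∀ z ∈ C, 0 ≤ inner ℝ (F x - y + ϱ • gradient r x) (z - x)) :
    SolvesRegularizedInclusion C F y ϱ r x := by
  refine Set.mem_add.2 ⟨_, rfl, -(F x - y + ϱ • gradient r x), ⟨hx, fun z hz => ?_⟩, by simp⟩
  rw [inner_neg_right, real_inner_comm]
  exact neg_nonpos.2 (h z hz)

open Filter Topology in
theorem proposition4 {n : ℕ} (C : Set (EuclideanSpace ℝ (Fin n)))
    (hC_closed : IsClosed C) (hC_convex : Convex ℝ C) (hC_int : (interior C).Nonempty)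
    (F : EuclideanSpace ℝ (Fin n) → EuclideanSpace ℝ (Fin n))
    (hF_cont : ContinuousOn F C) (hF_mono : IsMonotoneOperatorOn F C)
    (y : EuclideanSpace ℝ (Fin n)) (ϱ : ℝ) (hϱ : 0 ≤ ϱ)
    (r : EuclideanSpace ℝ (Fin n) → ℝ) (hr_diff : Differentiable ℝ r)
    (hr_conv : ConvexOn ℝ Set.univ r)
    (h : (0 < ϱ ∧ IsStronglyConvex r) ∨ Bornology.IsBounded C) :
    ∃ x : EuclideanSpace ℝ (Fin n), SolvesRegularizedInclusion C F y ϱ r x := by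
  obtain ⟨x₀, hx₀⟩ := hC_int.mono interior_subset
  have hmono : ∀ x ∈ C, ∀ z ∈ C, 0 ≤ inner ℝ ((F x - y) - (F z - y)) (x - z) := fun x hx z hz => by
    simpa using hF_mono x hx z hz
  have hconv : ConvexOn ℝ Set.univ fun x => ϱ * r x := hr_conv.smul hϱ
  have hcont : Continuous fun x => ϱ * r x := continuous_const.mul hr_diff.continuous
  have hlocal {x : EuclideanSpace ℝ (Fin n)} (hx : x ∈ C)
      (hmin : ∀ᶠ z in 𝓝[C] x, 0 ≤ inner ℝ (F z - y) (z - x) + (ϱ * r z - ϱ * r x)) :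
      SolvesRegularizedInclusion C F y ϱ r x :=
    solvesRegularizedInclusion_of_forall_inner_nonneg hx fun z hz =>
      inner_add_gradient_nonneg_of_minty (G := fun x => F x - y) hC_convex hx
        ((hF_cont x hx).sub continuousWithinAt_const) (hr_diff x) hmin hz
  rcases h with ⟨hϱ0, β, hβ, hr⟩ | hbdd
  · set M := ‖F x₀ - y + ϱ • gradient r x₀‖ with hM
    have hκ : 0 < ϱ * (β / 2) := by positivity
    -- The quotient bounds `‖x₀ - x‖`; the `+ 1` puts `x` in the open ball.
    set R := M / (ϱ * (β / 2)) + 1 with hR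
    have hR0 : 0 ≤ R := by positivity
    obtain ⟨x, ⟨hxC, hxR⟩, hx⟩ := exists_minty_solution
      (K := C ∩ Metric.closedBall x₀ R) ((isCompact_closedBall x₀ R).inter_left hC_closed)
      (hC_convex.inter (convex_closedBall x₀ R)) ⟨x₀, hx₀, Metric.mem_closedBall_self hR0⟩
      (fun x hx z hz => hmono x hx.1 z hz.1)
      (hconv.subset (Set.subset_univ _) (hC_convex.inter (convex_closedBall x₀ R))) hcont
    have hlt : ‖x₀ - x‖ < R := by
      -- Testing with `x₀` and adding strong convexity at `x₀` gives a quadratic term bounded by a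
      -- linear one.
      have h₀ := hx x₀ ⟨hx₀, Metric.mem_closedBall_self hR0⟩
      have h₁ := mul_le_mul_of_nonneg_left (hr.inner_gradient_add_le (hr_diff x₀) x) hϱ
      have h₂ : inner ℝ (F x₀ - y + ϱ • gradient r x₀) (x₀ - x) ≤ M * ‖x₀ - x‖ :=
        real_inner_le_norm _ _
      have hswap : inner ℝ (gradient r x₀) (x - x₀) = -inner ℝ (gradient r x₀) (x₀ - x) := by
        rw [← inner_neg_right, neg_sub]
      rw [hswap] at h₁
      rw [inner_add_left, real_inner_smul_left] at h₂
      have h₃ : (ϱ * (β / 2) * ‖x₀ - x‖) * ‖x₀ - x‖ ≤ M * ‖x₀ - x‖ := by linarith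
      rcases (norm_nonneg (x₀ - x)).eq_or_lt with h0 | hpos
      · rw [← h0]
        positivity
      · have h₄ : ‖x₀ - x‖ ≤ M / (ϱ * (β / 2)) := by
          rw [le_div_iff₀ hκ, mul_comm]
          exact le_of_mul_le_mul_right h₃ hpos
        linarith
    refine ⟨x, hlocal hxC ?_⟩
    have hball : Metric.ball x₀ R ∈ 𝓝 x :=
      Metric.isOpen_ball.mem_nhds (by rwa [Metric.mem_ball', dist_eq_norm])
    filter_upwards [self_mem_nhdsWithin, mem_nhdsWithin_of_mem_nhds hball] with z hzC hzR
    exact hx z ⟨hzC, Metric.ball_subset_closedBall hzR⟩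
  · obtain ⟨x, hxC, hx⟩ := exists_minty_solution
      (Metric.isCompact_of_isClosed_isBounded hC_closed hbdd) hC_convex ⟨x₀, hx₀⟩ hmono
      (hconv.subset (Set.subset_univ _) hC_convex) hcont
    refine ⟨x, hlocal hxC ?_⟩
    filter_upwards [self_mem_nhdsWithin] with z hz
    exact hx z hz
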